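/- **Setting.** Identify $\mathfrak{se}(3)$ with pairs $\theta=(\omega,v)\in\mathbb{R}^3\times\mathbb{R}^3$, with norm $\|\theta\|=(\|\omega\|^2+\|v\|^2)^{1/2}$ and the corresponding inner product, where $(\omega,v)$ stands for the $4\times4$ matrix $\begin{pmatrix}\Omega & v\\ 0&0\end{pmatrix}$ and $\Omega$ is the skew-symmetric matrix $\Omega x=\omega\times x$. Let $\exp:\mathfrak{se}(3)\to \mathrm{SE}(3)\subset\mathbb{R}^{4\times 4}$ be the matrix exponential, and give $\mathbb{R}^{4\times4}$ the Frobenius norm $\|\cdot\|_F$. Let $\widetilde J$ be a real function on $\mathrm{SE}(3)$ and $J(\theta)=\widetilde J(\exp\theta)$. Suppose there are constants $M_1,M_2\ge 0$ such that for every $R>0$ and every $g$ in $\{\exp\theta:\|\theta\|\le R\}$, the function $\widetilde J$ is $C^2$ at $g$ with $\|\nabla\widetilde J(g)\|_F\le M_1$ and $\|\nabla^2\widetilde J(g)\|_{\mathrm{op}}\le M_2$; the constants $M_1,M_2$ do not depend on $R$. Here gradient and Hessian are the Euclidean ones on $\mathbb{R}^{4\times4}$, taken of a local extension: the condition at $g$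 means that there is a function $F$ on $\mathbb{R}^{4\times 4}$ which is $C^2$ near $g$, agrees with $\widetilde J$ on $\mathrm{SE}(3)$ near $g$, and satisfies $\|\nabla F(g)\|_F\le M_1$ and $\|\nabla^2F(g)\|_{\mathrm{op}}\le M_2$, the operator norm being taken with respect to $\|\cdot\|_F$. (If $\widetilde J$ is given as a $C^2$ function on a neighbourhood of $\mathrm{SE}(3)$, one may take $F=\widetilde J$.) **Proposition 3.3.** Then $J$ is differentiable, and for every $R\ge 1$ the gradient Lipschitz constant $$L(R)=\sup_{\substack{\|\theta\|,\|\theta'\|\le R\\ \theta\ne\theta'}}\frac{\|\nabla J(\theta)-\nabla J(\theta')\|}{\|\theta-\theta'\|}$$ satisfies $$L(R)\le \frac{5(\sqrt2+1)}{3}\,(M_1+M_2)\,R^2,\qquad \left|\frac{5(\sqrt2+1)}{3}-4.02\right|<0.005 .$$ -/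

import Mathlib

open scoped Matrix ENNReal Topology Gradient

-- Matrices carry the Frobenius norm throughout.
attribute [local instance] Matrix.frobeniusNormedAddCommGroup Matrix.frobeniusNormedSpace

/-- `4 × 4` real matrices, with rows and columns split into blocks of sizes `3` and `1`. -/
abbrev Mat4 : Type := Matrix (Fin 3 ⊕ Fin 1) (Fin 3 ⊕ Fin 1) ℝ

/-- The space of pairs `(ω, v) ∈ ℝ³ × ℝ³` identified with the Lie algebra `se(3)`, carrying the
6-vector norm `‖(ω, v)‖ = (‖ω‖² + ‖v‖²)^(1/2)` and the corresponding inner product. -/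
abbrev LieSE3 : Type := WithLp 2 (EuclideanSpace ℝ (Fin 3) × EuclideanSpace ℝ (Fin 3))

/-- The skew-symmetric matrix `Ω` with axial vector `ω`, i.e. `Ω x = ω × x`. -/
def skewMat (ω : EuclideanSpace ℝ (Fin 3)) : Matrix (Fin 3) (Fin 3) ℝ :=
  !![0, -ω 2, ω 1;
     ω 2, 0, -ω 0;
     -ω 1, ω 0, 0]

/-- The homogeneous matrix `[[Ω, v], [0, 0]]` of the element `(ω, v)` of `se(3)`. -/
def LieSE3.toMat (θ : LieSE3) : Mat4 :=
  Matrix.fromBlocks (skewMat θ.fst) (Matrix.replicateCol (Fin 1) (fun i => θ.snd i)) 0 0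

/-- The exponential map of `se(3)`: the matrix exponential of the homogeneous matrix. -/
noncomputable def expSE3 (θ : LieSE3) : Mat4 := NormedSpace.exp θ.toMat

/-- The group `SE(3)`, as the set of matrices `[[Q, t], [0, 1]]` with `Q ∈ SO(3)`, `t ∈ ℝ³`. -/
def groupSE3 : Set Mat4 :=
  {g | ∃ Q ∈ Matrix.specialOrthogonalGroup (Fin 3) ℝ, ∃ t : Fin 3 → ℝ,
    g = Matrix.fromBlocks Q (Matrix.replicateCol (Fin 1) t) 0 1}

/-- The Euclidean gradient of a function of a matrix: the matrix of its partial derivatives. -/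
noncomputable def matGrad (F : Mat4 → ℝ) (g : Mat4) : Mat4 :=
  Matrix.of fun i j => fderiv ℝ F g (Matrix.single i j 1)

/-- The Hessian of a function of a matrix: the derivative of its gradient, a linear operator on
matrices, here applied to the matrix `X`. -/
noncomputable def matHess (F : Mat4 → ℝ) (g X : Mat4) : Mat4 :=
  fderiv ℝ (matGrad F) g X

/-- At the point `g`, the function `Jt` on `SE(3)` is of class `C²`, with gradient bounded by `M₁`
in the Frobenius norm and Hessian bounded by `M₂` in the operator norm
(with respect to the Frobenius norm). As `SE(3)` has empty
interior in the space of matrices, the derivatives are taken of a local extension `F` of `Jt`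
(so the values of `Jt` outside `SE(3)` play no role). If `Jt` itself is `C²` near `g` as a
function of the matrix entries, one may take `F = Jt`. -/
def DerivBoundsAt (Jt : Mat4 → ℝ) (M₁ M₂ : ℝ) (g : Mat4) : Prop :=
  ∃ F : Mat4 → ℝ, F =ᶠ[𝓝[groupSE3] g] Jt ∧ ContDiffAt ℝ 2 F g ∧
    ‖matGrad F g‖ ≤ M₁ ∧ ∀ X : Mat4, ‖matHess F g X‖ ≤ M₂ * ‖X‖

/-- The image `{exp θ : ‖θ‖ ≤ R}` of the closed ball of radius `R`. -/
def expBall (R : ℝ) : Set Mat4 := expSE3 '' Metric.closedBall 0 R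

/-- `Jt` has gradient bounded by `M₁` and Hessian bounded by `M₂` on the exponential image of
every ball, with `M₁`, `M₂` independent of the radius. -/
def BoundedClass (Jt : Mat4 → ℝ) (M₁ M₂ : ℝ) : Prop :=
  0 ≤ M₁ ∧ 0 ≤ M₂ ∧ ∀ R : ℝ, 0 < R → ∀ g ∈ expBall R, DerivBoundsAt Jt M₁ M₂ g

/-- The gradient Lipschitz constant of `J` on the closed ball of radius `R`: the supremum of
`‖∇ J θ - ∇ J θ'‖ / ‖θ - θ'‖` over distinct `θ, θ'` in the ball, as an element of `[0, ∞]`. -/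
noncomputable def gradLipConst (J : LieSE3 → ℝ) (R : ℝ) : ℝ≥0∞ :=
  ⨆ (θ ∈ Metric.closedBall (0 : LieSE3) R) (θ' ∈ Metric.closedBall (0 : LieSE3) R) (_ : θ ≠ θ'),
    ENNReal.ofReal (‖∇ J θ - ∇ J θ'‖ / ‖θ - θ'‖)

/-! ### Calculus of the matrix exponential in the Frobenius norm -/

/-! Write `E = expSE3` and let `F` be a local extension of `Jt`. The second derivative of `F ∘ E` is
`D²F(DE, DE) + DF(D²E)`, so it suffices to show `‖DE‖ ≤ 2R` and `‖D²E‖ ≤ 4R` on the ball of radius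
`R`. This gives `4R²M₂ + 4RM₁ ≤ 4(M₁ + M₂)R²`; since `4 < 5(√2 + 1)/3`, the mean value inequality on
the convex ball finishes.

No formula for `DE` is needed. The path `s ↦ e^{sB} e^{(1-s)A}` has derivative `e^{sB}(B -
A)e^{(1-s)A}`. Its left factor is rigid and preserves the Frobenius norm of matrices with zero last
row (`IsRigid.norm_mul`); the right factor costs at most `2R` (`IsRigid.norm_toMat_mul_le`). This
bounds first differences of `E`, and comparing two such paths bounds second differences
(`norm_expSE3_second_difference_le`), hence `D²E`. -/

theorem contDiff_matrix_exp {n : WithTop ℕ∞} :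
    ContDiff ℝ n (NormedSpace.exp : Mat4 → Mat4) := by
  let : NormedRing Mat4 := Matrix.frobeniusNormedRing
  let : NormedAlgebra ℝ Mat4 := Matrix.frobeniusNormedAlgebra
  exact contDiff_iff_contDiffAt.2 fun x => (NormedSpace.exp_analytic (𝕂 := ℝ) x).contDiffAt

theorem hasDerivAt_matrix_exp_smul (A : Mat4) (t : ℝ) :
    HasDerivAt (fun s : ℝ => NormedSpace.exp (s • A)) (NormedSpace.exp (t • A) * A) t := by
  let : NormedRing Mat4 := Matrix.frobeniusNormedRing
  let : NormedAlgebra ℝ Mat4 := Matrix.frobeniusNormedAlgebra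
  exact hasDerivAt_exp_smul_const A t

theorem hasDerivAt_matrix_exp_smul' (A : Mat4) (t : ℝ) :
    HasDerivAt (fun s : ℝ => NormedSpace.exp (s • A)) (A * NormedSpace.exp (t • A)) t := by
  let : NormedRing Mat4 := Matrix.frobeniusNormedRing
  let : NormedAlgebra ℝ Mat4 := Matrix.frobeniusNormedAlgebra
  exact hasDerivAt_exp_smul_const' A t

theorem HasDerivAt.matrix_mul {f g : ℝ → Mat4} {f' g' : Mat4} {t : ℝ}
    (hf : HasDerivAt f f' t) (hg : HasDerivAt g g' t) :
    HasDerivAt (fun s => f s * g s) (f' * g t + f t * g') t := by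
  let : NormedRing Mat4 := Matrix.frobeniusNormedRing
  let : NormedAlgebra ℝ Mat4 := Matrix.frobeniusNormedAlgebra
  exact hf.mul hg

theorem HasDerivAt.matrix_mul_const {f : ℝ → Mat4} {f' : Mat4} {t : ℝ}
    (hf : HasDerivAt f f' t) (X : Mat4) : HasDerivAt (fun s => f s * X) (f' * X) t := by
  simpa using hf.matrix_mul (hasDerivAt_const t X)

theorem HasDerivAt.matrix_entry {f : ℝ → Mat4} {f' : Mat4} {t : ℝ} (hf : HasDerivAt f f' t)
    (i j : Fin 3 ⊕ Fin 1) : HasDerivAt (fun s => f s i j) (f' i j) t :=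
  (LinearMap.toContinuousLinearMap
    (Matrix.entryLinearMap ℝ ℝ i j)).hasFDerivAt.comp_hasDerivAt t hf

/-- The derivative of the path `s ↦ e^{sB} e^{(1-s)A}` from `e^A` to `e^B`. -/
theorem hasDerivAt_exp_mul_exp (A B : Mat4) (t : ℝ) :
    HasDerivAt (fun s : ℝ => NormedSpace.exp (s • B) * NormedSpace.exp ((1 - s) • A))
      (NormedSpace.exp (t • B) * (B - A) * NormedSpace.exp ((1 - t) • A)) t := by
  have h2 : HasDerivAt (fun s : ℝ => NormedSpace.exp ((1 - s) • A))
      ((-1 : ℝ) • (A * NormedSpace.exp ((1 - t) • A))) t :=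
    (hasDerivAt_matrix_exp_smul' A (1 - t)).scomp t ((hasDerivAt_id t).const_sub 1)
  refine ((hasDerivAt_matrix_exp_smul B t).matrix_mul h2).congr_deriv ?_
  simp only [neg_smul, one_smul, mul_sub, sub_mul, mul_neg, Matrix.mul_assoc]
  abel

theorem norm_sub_le_of_hasDerivAt_unit_interval {E : Type*} [NormedAddCommGroup E]
    [NormedSpace ℝ E] {f f' : ℝ → E} {C : ℝ} (hf : ∀ t, HasDerivAt f (f' t) t)
    (hC : ∀ t, 0 ≤ t → t ≤ 1 → ‖f' t‖ ≤ C) : ‖f 1 - f 0‖ ≤ C :=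
  norm_image_sub_le_of_norm_deriv_le_segment_01' (fun t _ => (hf t).hasDerivWithinAt)
    fun t ht => hC t ht.1 ht.2.le

/-! ### Frobenius norms of products -/

theorem frobenius_norm_sq (X : Mat4) : ‖X‖ ^ 2 = ∑ i, ∑ j, X i j ^ 2 := by
  have h := Matrix.frobenius_norm_def X
  simp only [← Real.sqrt_eq_rpow, Real.norm_eq_abs, Real.rpow_ofNat, sq_abs] at h
  rw [h]
  exact Real.sq_sqrt (Finset.sum_nonneg fun _ _ => Finset.sum_nonneg fun _ _ => sq_nonneg _)

/-- The last row of `X` vanishes. -/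
def BotZero (X : Mat4) : Prop := ∀ j, X (Sum.inr 0) j = 0

theorem BotZero.norm_sq {X : Mat4} (hX : BotZero X) :
    ‖X‖ ^ 2 = ∑ j, (X (Sum.inl 0) j ^ 2 + X (Sum.inl 1) j ^ 2 + X (Sum.inl 2) j ^ 2) := by
  rw [frobenius_norm_sq, Finset.sum_comm]
  refine Finset.sum_congr rfl fun j _ => ?_
  simp [Fintype.sum_sum_type, Fin.sum_univ_three, hX j]

theorem BotZero.mul {X : Mat4} (hX : BotZero X) (Y : Mat4) : BotZero (X * Y) := fun j => by
  simp [Matrix.mul_apply, hX _]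

theorem botZero_toMat (ξ : LieSE3) : BotZero ξ.toMat := by
  rintro (j | j) <;> simp [LieSE3.toMat]

/-- Matrices `[[Q, t], [0, 1]]` with `QᵀQ = 1`. -/
structure IsRigid (g : Mat4) : Prop where
  bot : ∀ j, g (Sum.inr 0) j = (1 : Mat4) (Sum.inr 0) j
  orth : g.toBlocks₁₁ᵀ * g.toBlocks₁₁ = 1

theorem IsRigid.mul_botZero {g X : Mat4} (hg : IsRigid g) (hX : BotZero X) :
    BotZero (g * X) := fun j => by
  simp [Matrix.mul_apply, hg.bot, Matrix.one_apply, hX j]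

/-- A zero last row annihilates the translation part of `g`, and the rotation block acts
isometrically on each column. -/
theorem IsRigid.norm_mul {g X : Mat4} (hg : IsRigid g) (hX : BotZero X) : ‖g * X‖ = ‖X‖ := by
  refine (sq_eq_sq₀ (norm_nonneg _) (norm_nonneg _)).1 ?_
  rw [(hg.mul_botZero hX).norm_sq, hX.norm_sq]
  refine Finset.sum_congr rfl fun j _ => ?_
  have h (a b : Fin 3) := congrFun (congrFun hg.orth a) b
  simp only [Matrix.mul_apply, Fin.sum_univ_three, Matrix.transpose_apply, Matrix.toBlocks₁₁,
    Matrix.of_apply] at h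
  have h00 := h 0 0
  have h01 := h 0 1
  have h02 := h 0 2
  have h11 := h 1 1
  have h12 := h 1 2
  have h22 := h 2 2
  simp at h00 h01 h02 h11 h12 h22
  simp only [Matrix.mul_apply, Fintype.sum_sum_type, Fin.sum_univ_three, Fin.sum_univ_one,
    hX j, mul_zero, add_zero]
  set x := X (Sum.inl 0) j
  set y := X (Sum.inl 1) j
  set z := X (Sum.inl 2) j
  linear_combination x ^ 2 * h00 + y ^ 2 * h11 + z ^ 2 * h22 + 2 * x * y * h01 +
    2 * x * z * h02 + 2 * y * z * h12

theorem norm_sq_eq_coords (w : EuclideanSpace ℝ (Fin 3)) :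
    ‖w‖ ^ 2 = w 0 ^ 2 + w 1 ^ 2 + w 2 ^ 2 := by
  simp [EuclideanSpace.norm_sq_eq, Fin.sum_univ_three]

theorem LieSE3.norm_sq (ξ : LieSE3) : ‖ξ‖ ^ 2 = ‖ξ.fst‖ ^ 2 + ‖ξ.snd‖ ^ 2 :=
  WithLp.prod_norm_sq_eq_of_L2 ξ

theorem LieSE3.norm_fst_le (ξ : LieSE3) : ‖ξ.fst‖ ≤ ‖ξ‖ :=
  le_of_sq_le_sq (by nlinarith [ξ.norm_sq, sq_nonneg ‖ξ.snd‖]) (norm_nonneg _)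

theorem LieSE3.norm_snd_le (ξ : LieSE3) : ‖ξ.snd‖ ≤ ‖ξ‖ :=
  le_of_sq_le_sq (by nlinarith [ξ.norm_sq, sq_nonneg ‖ξ.fst‖]) (norm_nonneg _)

/-- `|ω × x|² ≤ |ω|² |x|²` in coordinates. -/
theorem cross_sq_le (a b c x y z : ℝ) :
    (b * z - c * y) ^ 2 + (c * x - a * z) ^ 2 + (a * y - b * x) ^ 2 ≤
      (a ^ 2 + b ^ 2 + c ^ 2) * (x ^ 2 + y ^ 2 + z ^ 2) := by
  nlinarith [sq_nonneg (a * x + b * y + c * z)]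

theorem norm_toMat_mul_le (ξ : LieSE3) {X : Mat4} (hX : BotZero X) :
    ‖ξ.toMat * X‖ ≤ ‖ξ‖ * ‖X‖ := by
  refine le_trans (le_of_sq_le_sq ?_ (mul_nonneg (norm_nonneg ξ.fst) (norm_nonneg X)))
    (mul_le_mul_of_nonneg_right ξ.norm_fst_le (norm_nonneg X))
  rw [mul_pow, ((botZero_toMat ξ).mul X).norm_sq, hX.norm_sq, Finset.mul_sum, norm_sq_eq_coords]
  refine Finset.sum_le_sum fun j _ => ?_
  refine le_trans (le_of_eq ?_) (cross_sq_le _ _ _ _ _ _)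
  simp [Matrix.mul_apply, LieSE3.toMat, skewMat, Fintype.sum_sum_type, Fin.sum_univ_three, hX j]
  ring

/-- The translation part of `g` has length at most `τ`. -/
def TransLE (g : Mat4) (τ : ℝ) : Prop :=
  g (Sum.inl 0) (Sum.inr 0) ^ 2 + g (Sum.inl 1) (Sum.inr 0) ^ 2 +
    g (Sum.inl 2) (Sum.inr 0) ^ 2 ≤ τ ^ 2

/-- For `g = [[Q, t], [0, 1]]` the product is `[[ΩQ, ω × t + v], [0, 0]]`. Here `‖ΩQ‖² = 2|ω|²` and
`|ω × t + v|² ≤ 2R²|ω|² + 2|v|²`, and `R ≥ 1` absorbs everything into `4R²‖ξ‖²`. -/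
theorem IsRigid.norm_toMat_mul_le {g : Mat4} (hg : IsRigid g) {R : ℝ} (hR : 1 ≤ R)
    (ht : TransLE g R) (ξ : LieSE3) : ‖ξ.toMat * g‖ ≤ 2 * R * ‖ξ‖ := by
  refine le_of_sq_le_sq ?_ (by positivity)
  rw [mul_pow, ((botZero_toMat ξ).mul g).norm_sq, ξ.norm_sq, norm_sq_eq_coords,
    norm_sq_eq_coords]
  -- `‖ΩQ‖² = tr(Ω QQᵀ Ωᵀ)` calls for orthonormal rows rather than columns.
  have horth : g.toBlocks₁₁ * g.toBlocks₁₁ᵀ = 1 := mul_eq_one_comm.1 hg.orth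
  have h (a b : Fin 3) := congrFun (congrFun horth a) b
  simp only [Matrix.mul_apply, Fin.sum_univ_three, Matrix.transpose_apply, Matrix.toBlocks₁₁,
    Matrix.of_apply] at h
  have h00 := h 0 0
  have h01 := h 0 1
  have h02 := h 0 2
  have h11 := h 1 1
  have h12 := h 1 2
  have h22 := h 2 2
  have hb := hg.bot
  simp [Matrix.one_apply] at h00 h01 h02 h11 h12 h22 hb
  unfold TransLE at ht
  simp [Matrix.mul_apply, LieSE3.toMat, skewMat, Fintype.sum_sum_type, Fin.sum_univ_three, hb]
  set a := ξ.fst 0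
  set b := ξ.fst 1
  set c := ξ.fst 2
  set u := ξ.snd 0
  set v := ξ.snd 1
  set w := ξ.snd 2
  set x := g (Sum.inl 0) (Sum.inr 0)
  set y := g (Sum.inl 1) (Sum.inr 0)
  set z := g (Sum.inl 2) (Sum.inr 0)
  have hc := cross_sq_le a b c x y z
  have hR2 : 1 ≤ R ^ 2 := by nlinarith
  have hω : 0 ≤ a ^ 2 + b ^ 2 + c ^ 2 := by positivity
  have hv : 0 ≤ u ^ 2 + v ^ 2 + w ^ 2 := by positivity
  have h1 := mul_le_mul_of_nonneg_left ht hω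
  have h2 := mul_le_mul_of_nonneg_left hR2 hω
  have h3 := mul_le_mul_of_nonneg_left hR2 hv
  have h4 : (-(c * y) + b * z + u) ^ 2 + (c * x + -(a * z) + v) ^ 2 + (-(b * x) + a * y + w) ^ 2
      ≤ 2 * ((b * z - c * y) ^ 2 + (c * x - a * z) ^ 2 + (a * y - b * x) ^ 2) +
        2 * (u ^ 2 + v ^ 2 + w ^ 2) := by
    have q (p r : ℝ) : (p + r) ^ 2 ≤ 2 * p ^ 2 + 2 * r ^ 2 := by
      linarith [sq_nonneg (p - r)]
    linarith [q (-(c * y) + b * z) u, q (c * x + -(a * z)) v, q (-(b * x) + a * y) w]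
  have h5 : (-(c * y) + b * z + u) ^ 2 + (c * x + -(a * z) + v) ^ 2 +
      (-(b * x) + a * y + w) ^ 2 + 2 * (a ^ 2 + b ^ 2 + c ^ 2) ≤
      (2 * R) ^ 2 * (a ^ 2 + b ^ 2 + c ^ 2 + (u ^ 2 + v ^ 2 + w ^ 2)) := by
    linarith
  refine le_trans (le_of_eq ?_) h5
  linear_combination (b ^ 2 + c ^ 2) * h00 + (a ^ 2 + c ^ 2) * h11 + (a ^ 2 + b ^ 2) * h22 -
    2 * a * b * h01 - 2 * a * c * h02 - 2 * b * c * h12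

/-! ### The exponential of `se(3)` -/

/-- `LieSE3.toMat` as a linear map. -/
def LieSE3.toMatLin : LieSE3 →ₗ[ℝ] Mat4 where
  toFun := LieSE3.toMat
  map_add' x y := by
    ext (i | i) (j | j) <;> simp [LieSE3.toMat]
    fin_cases i <;> fin_cases j <;> simp [skewMat] <;> ring
  map_smul' r x := by
    ext (i | i) (j | j) <;> simp [LieSE3.toMat]
    fin_cases i <;> fin_cases j <;> simp [skewMat]

theorem LieSE3.toMat_smul (r : ℝ) (θ : LieSE3) : (r • θ).toMat = r • θ.toMat :=
  LieSE3.toMatLin.map_smul r θ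

theorem LieSE3.toMat_sub (θ θ' : LieSE3) : (θ - θ').toMat = θ.toMat - θ'.toMat :=
  LieSE3.toMatLin.map_sub θ θ'

theorem LieSE3.contDiff_toMat {n : WithTop ℕ∞} : ContDiff ℝ n LieSE3.toMat := by
  -- Boundedness of the linear map is the rigid estimate at `g = 1`, `R = 1`.
  have h1 : IsRigid 1 := ⟨fun _ => rfl, by
    ext i j
    simp [Matrix.mul_apply, Matrix.toBlocks₁₁, Matrix.one_apply, eq_comm]⟩
  have h2 : TransLE 1 1 := by simp [TransLE]
  have hb : IsBoundedLinearMap ℝ LieSE3.toMatLin :=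
    LieSE3.toMatLin.isLinear.with_bound 2 fun ξ => by
      simpa [LieSE3.toMatLin] using h1.norm_toMat_mul_le le_rfl h2 ξ
  exact hb.contDiff

theorem contDiff_expSE3 {n : WithTop ℕ∞} : ContDiff ℝ n expSE3 :=
  contDiff_matrix_exp.comp LieSE3.contDiff_toMat

theorem expSE3_zero : expSE3 0 = 1 := by
  have h : (0 : LieSE3).toMat = 0 := LieSE3.toMatLin.map_zero
  simp [expSE3, h]

theorem hasDerivAt_expSE3_smul (θ : LieSE3) (t : ℝ) :
    HasDerivAt (fun s : ℝ => expSE3 (s • θ)) (expSE3 (t • θ) * θ.toMat) t := by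
  simpa only [expSE3, LieSE3.toMat_smul] using hasDerivAt_matrix_exp_smul θ.toMat t

theorem hasDerivAt_expSE3_smul' (θ : LieSE3) (t : ℝ) :
    HasDerivAt (fun s : ℝ => expSE3 (s • θ)) (θ.toMat * expSE3 (t • θ)) t := by
  simpa only [expSE3, LieSE3.toMat_smul] using hasDerivAt_matrix_exp_smul' θ.toMat t

theorem hasDerivAt_expSE3_mul_expSE3 (θ θ' : LieSE3) (t : ℝ) :
    HasDerivAt (fun s : ℝ => expSE3 (s • θ') * expSE3 ((1 - s) • θ))
      (expSE3 (t • θ') * (θ' - θ).toMat * expSE3 ((1 - t) • θ)) t := by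
  simpa only [expSE3, LieSE3.toMat_smul, LieSE3.toMat_sub] using
    hasDerivAt_exp_mul_exp θ.toMat θ'.toMat t

theorem eq_of_hasDerivAt_zero {f f' : ℝ → ℝ} (hf : ∀ t, HasDerivAt f (f' t) t)
    (h0 : ∀ t, f' t = 0) (x y : ℝ) : f x = f y :=
  is_const_of_deriv_eq_zero (fun t => (hf t).differentiableAt)
    (fun t => (hf t).deriv.trans (h0 t)) x y

theorem expSE3_bot (θ : LieSE3) (j : Fin 3 ⊕ Fin 1) :
    expSE3 θ (Sum.inr 0) j = (1 : Mat4) (Sum.inr 0) j := by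
  have h := eq_of_hasDerivAt_zero
    (fun t => (hasDerivAt_expSE3_smul' θ t).matrix_entry (Sum.inr 0) j)
    (fun t => (botZero_toMat θ).mul _ j) 1 0
  simpa [expSE3_zero] using h

theorem isRigid_expSE3 (θ : LieSE3) : IsRigid (expSE3 θ) where
  bot := expSE3_bot θ
  orth := by
    ext a b
    have hd (i : Fin 3) (j : Fin 3) (t : ℝ) :=
      (hasDerivAt_expSE3_smul' θ t).matrix_entry (Sum.inl i) (Sum.inl j)
    -- Each entry of `QᵀQ` is constant along `s ↦ e^{sθ}`: its derivative is an entry of `Qᵀ(Ωᵀ +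
    -- Ω)Q = 0`.
    have h := eq_of_hasDerivAt_zero (fun t =>
      ((((hd 0 a t).mul (hd 0 b t)).add ((hd 1 a t).mul (hd 1 b t))).add
        ((hd 2 a t).mul (hd 2 b t)))) (fun t => by
          simp [Matrix.mul_apply, LieSE3.toMat, skewMat, Fintype.sum_sum_type,
            Fin.sum_univ_three, expSE3_bot]
          ring) 1 0
    simp [expSE3_zero, Matrix.one_apply] at h
    simp [Matrix.mul_apply, Matrix.toBlocks₁₁, Fin.sum_univ_three, h]
    fin_cases a <;> fin_cases b <;> simp

/-- The last column of `e^{sθ}` moves with velocity `e^{sθ}(v, 0)`, whose length is `|v|` by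
rigidity. -/
theorem transLE_expSE3 {θ : LieSE3} {R : ℝ} (h : ‖θ‖ ≤ R) : TransLE (expSE3 θ) R := by
  set e : Mat4 := Matrix.single (Sum.inr 0) (Sum.inr 0) 1 with he
  set V : Mat4 := θ.toMat * e with hV
  have hVb : BotZero V := (botZero_toMat θ).mul e
  have hVn : ‖V‖ = ‖θ.snd‖ := by
    refine (sq_eq_sq₀ (norm_nonneg _) (norm_nonneg _)).1 ?_
    rw [hVb.norm_sq, norm_sq_eq_coords]
    simp [hV, he, Fintype.sum_sum_type, LieSE3.toMat]
  have hn := norm_sub_le_of_hasDerivAt_unit_interval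
    (fun t => (hasDerivAt_expSE3_smul θ t).matrix_mul_const e) (C := ‖θ.snd‖) (fun t _ _ => by
      rw [Matrix.mul_assoc, (isRigid_expSE3 _).norm_mul hVb, hVn])
  rw [one_smul, zero_smul, expSE3_zero, ← sub_mul] at hn
  have hb : BotZero (expSE3 θ - 1) := fun j => by simp [expSE3_bot]
  have h2 := pow_le_pow_left₀ (norm_nonneg _) (hn.trans (θ.norm_snd_le.trans h)) 2
  rw [(hb.mul e).norm_sq] at h2
  simpa [he, Fintype.sum_sum_type, TransLE] using h2

theorem expSE3_mem_groupSE3 (θ : LieSE3) : expSE3 θ ∈ groupSE3 := by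
  set Q := (expSE3 θ).toBlocks₁₁
  have horth : Q * Qᵀ = 1 := mul_eq_one_comm.1 (isRigid_expSE3 θ).orth
  refine ⟨Q, Matrix.mem_specialOrthogonalGroup_iff.2
    ⟨(Matrix.mem_orthogonalGroup_iff (Fin 3) ℝ).2 ?_, ?_⟩,
    fun i => expSE3 θ (Sum.inl i) (Sum.inr 0), ?_⟩
  · exact horth
  -- The determinant is a square, `e^θ = (e^{θ/2})²`, which excludes the value `-1`.
  · set g := expSE3 ((1 / 2 : ℝ) • θ) with hg
    have hsq : expSE3 θ = g * g := by
      rw [hg, expSE3, expSE3, ← Matrix.exp_add_of_commute _ _ (Commute.refl _),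
        LieSE3.toMat_smul, ← add_smul]
      norm_num
    have hQ : Q = g.toBlocks₁₁ * g.toBlocks₁₁ := by
      ext i j
      simp [Q, hsq, Matrix.toBlocks₁₁, Matrix.mul_apply, Fintype.sum_sum_type,
        hg, expSE3_bot]
    have hdet := congrArg Matrix.det (isRigid_expSE3 ((1 / 2 : ℝ) • θ)).orth
    rw [Matrix.det_mul, Matrix.det_transpose, Matrix.det_one] at hdet
    rw [hQ, Matrix.det_mul, hdet]
  · ext (i | i) (j | j)
    · rfl
    · simp [Subsingleton.elim j 0]
    · simp [Subsingleton.elim i 0, expSE3_bot]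
    · simp [Subsingleton.elim i 0, Subsingleton.elim j 0, expSE3_bot]

theorem norm_expSE3_sub_mul_le (θ θ' : LieSE3) {X : Mat4} (hX : BotZero X) :
    ‖(expSE3 θ' - expSE3 θ) * X‖ ≤ ‖θ' - θ‖ * ‖X‖ := by
  have h := norm_sub_le_of_hasDerivAt_unit_interval
    (fun t => (hasDerivAt_expSE3_mul_expSE3 θ θ' t).matrix_mul_const X)
    (C := ‖θ' - θ‖ * ‖X‖) (fun t _ _ => by
      have hb := (isRigid_expSE3 ((1 - t) • θ)).mul_botZero hX
      rw [Matrix.mul_assoc, Matrix.mul_assoc,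
        (isRigid_expSE3 _).norm_mul ((botZero_toMat _).mul _)]
      exact (norm_toMat_mul_le _ hb).trans_eq (by rw [(isRigid_expSE3 _).norm_mul hX]))
  simpa [expSE3_zero, sub_mul] using h

theorem norm_toMat_mul_expSE3_le {θ : LieSE3} {R : ℝ} (hR : 1 ≤ R) (hθ : ‖θ‖ ≤ R)
    (ξ : LieSE3) : ‖ξ.toMat * expSE3 θ‖ ≤ 2 * R * ‖ξ‖ :=
  (isRigid_expSE3 θ).norm_toMat_mul_le hR (transLE_expSE3 hθ) ξ

theorem norm_smul_le_of_mem_unit_interval {θ : LieSE3} {R t : ℝ} (hθ : ‖θ‖ ≤ R) (h0 : 0 ≤ t)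
    (h1 : t ≤ 1) : ‖t • θ‖ ≤ R := by
  rw [norm_smul, Real.norm_of_nonneg h0]
  exact (mul_le_of_le_one_left (norm_nonneg θ) h1).trans hθ

theorem norm_expSE3_sub_le {θ : LieSE3} {R : ℝ} (hR : 1 ≤ R) (hθ : ‖θ‖ ≤ R) (θ' : LieSE3) :
    ‖expSE3 θ' - expSE3 θ‖ ≤ 2 * R * ‖θ' - θ‖ := by
  have h := norm_sub_le_of_hasDerivAt_unit_interval
    (fun t => hasDerivAt_expSE3_mul_expSE3 θ θ' t)
    (C := 2 * R * ‖θ' - θ‖) (fun t h0 h1 => by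
      rw [Matrix.mul_assoc, (isRigid_expSE3 _).norm_mul ((botZero_toMat _).mul _)]
      exact norm_toMat_mul_expSE3_le hR
        (norm_smul_le_of_mem_unit_interval hθ (sub_nonneg.2 h1) (sub_le_self 1 h0)) _)
  simpa [expSE3_zero] using h

/-- The second differences of the exponential are bilinearly bounded on balls. -/
theorem norm_expSE3_second_difference_le {θ θ' : LieSE3} {R : ℝ} (hR : 1 ≤ R) (hθ : ‖θ‖ ≤ R)
    (hθ' : ‖θ'‖ ≤ R) (k : LieSE3) :
    ‖(expSE3 (θ' + k) - expSE3 (θ + k)) - (expSE3 θ' - expSE3 θ)‖ ≤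
      2 * R * ‖θ' - θ‖ * ‖k‖ := by
  -- Both paths have increment `k`, one based at `θ'` and one at `θ`. Only the base points enter
  -- through right factors, so `θ + k` and `θ' + k` may leave the ball.
  have h := norm_sub_le_of_hasDerivAt_unit_interval
    (fun t => (hasDerivAt_expSE3_mul_expSE3 θ' (θ' + k) t).sub
      (hasDerivAt_expSE3_mul_expSE3 θ (θ + k) t))
    (C := 2 * R * ‖θ' - θ‖ * ‖k‖) (fun t h0 h1 => by
      have h2 : 0 ≤ 1 - t := sub_nonneg.2 h1
      have h3 : 1 - t ≤ 1 := sub_le_self 1 h0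
      rw [add_sub_cancel_left, add_sub_cancel_left]
      have hsplit : expSE3 (t • (θ' + k)) * k.toMat * expSE3 ((1 - t) • θ') -
          expSE3 (t • (θ + k)) * k.toMat * expSE3 ((1 - t) • θ) =
          (expSE3 (t • (θ' + k)) - expSE3 (t • (θ + k))) * (k.toMat * expSE3 ((1 - t) • θ')) +
          expSE3 (t • (θ + k)) *
            (k.toMat * (expSE3 ((1 - t) • θ') - expSE3 ((1 - t) • θ))) := by
        simp only [sub_mul, mul_sub, Matrix.mul_assoc]
        abel
      have b1 := norm_expSE3_sub_mul_le (t • (θ + k)) (t • (θ' + k))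
        ((botZero_toMat k).mul (expSE3 ((1 - t) • θ')))
      have b2 := norm_toMat_mul_expSE3_le hR (norm_smul_le_of_mem_unit_interval hθ' h2 h3) k
      have b3 := norm_expSE3_sub_le hR (norm_smul_le_of_mem_unit_interval hθ h2 h3)
        ((1 - t) • θ')
      have hb : BotZero (expSE3 ((1 - t) • θ') - expSE3 ((1 - t) • θ)) := fun j => by
        simp [expSE3_bot]
      have b4 := norm_toMat_mul_le k hb
      rw [← smul_sub, norm_smul, Real.norm_of_nonneg h0, add_sub_add_right_eq_sub] at b1
      rw [← smul_sub, norm_smul, Real.norm_of_nonneg h2] at b3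
      rw [hsplit]
      refine (norm_add_le _ _).trans ?_
      rw [(isRigid_expSE3 _).norm_mul ((botZero_toMat k).mul _)]
      have b5 := b1.trans (mul_le_mul_of_nonneg_left b2 (by positivity))
      have b6 := b4.trans (mul_le_mul_of_nonneg_left b3 (norm_nonneg k))
      -- The two terms carry weights `t` and `1 - t`, so the constant is `2R` and not `4R`.
      exact (add_le_add b5 b6).trans_eq (by ring))
  simp only [Pi.sub_apply, one_smul, zero_smul, sub_self, sub_zero, expSE3_zero, mul_one,
    one_mul] at h
  exact h

/-! ### Second order chain rule bounds -/

section ChainRule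

variable {V W : Type*} [NormedAddCommGroup V] [NormedSpace ℝ V] [NormedAddCommGroup W]
  [NormedSpace ℝ W]

/-- A bound on second differences near `x` bounds the second derivative at `x`. -/
theorem norm_fderiv_fderiv_le_of_second_difference {E : V → W} {x : V} {K : ℝ} (hK : 0 ≤ K)
    (hE : Differentiable ℝ E)
    (h : ∀ᶠ y in 𝓝 x, ∀ k, ‖(E (y + k) - E (x + k)) - (E y - E x)‖ ≤ K * ‖y - x‖ * ‖k‖) :
    ‖fderiv ℝ (fderiv ℝ E) x‖ ≤ K := by
  refine norm_fderiv_le_of_lip' ℝ hK (h.mono fun y hy => ?_)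
  -- `DE(y) - DE(x)` is the derivative at `k = 0` of `k ↦ E(y + k) - E(x + k)`, so the hypothesis is
  -- a Lipschitz bound for `DE` at `x`.
  have hd (z : V) : HasFDerivAt (fun k => E (z + k)) (fderiv ℝ E z) 0 := by
    rw [hasFDerivAt_comp_add_left, add_zero]
    exact (hE z).hasFDerivAt
  refine ((hd y).sub (hd x)).le_of_lip' (by positivity) (Filter.Eventually.of_forall fun k => ?_)
  simpa using hy k

theorem norm_fderiv_fderiv_comp_le {E : V → W} {F : W → ℝ} {x : V} {M₁ M₂ K K' : ℝ}
    (hE : ContDiff ℝ 2 E) (hF : ContDiffAt ℝ 2 F (E x)) (hM₁ : 0 ≤ M₁) (hM₂ : 0 ≤ M₂)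
    (h1 : ∀ X, ‖fderiv ℝ F (E x) X‖ ≤ M₁ * ‖X‖)
    (h2 : ∀ X Y, ‖fderiv ℝ (fderiv ℝ F) (E x) X Y‖ ≤ M₂ * ‖X‖ * ‖Y‖)
    (hK0 : 0 ≤ K) (hK0' : 0 ≤ K') (hEK : ∀ y, ‖E y - E x‖ ≤ K * ‖y - x‖)
    (hEK' : ∀ᶠ y in 𝓝 x, ∀ k,
      ‖(E (y + k) - E (x + k)) - (E y - E x)‖ ≤ K' * ‖y - x‖ * ‖k‖) :
    ‖fderiv ℝ (fderiv ℝ (F ∘ E)) x‖ ≤ M₂ * K ^ 2 + M₁ * K' := by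
  have hE1 : Differentiable ℝ E := hE.differentiable two_ne_zero
  have hK : ‖fderiv ℝ E x‖ ≤ K :=
    norm_fderiv_le_of_lip' ℝ hK0 (Filter.Eventually.of_forall hEK)
  have hK' := norm_fderiv_fderiv_le_of_second_difference hK0' hE1 hEK'
  have hE2 : Differentiable ℝ (fderiv ℝ E) :=
    (hE.fderiv_right (m := 1) (by norm_num)).differentiable one_ne_zero
  have hF2 : DifferentiableAt ℝ (fderiv ℝ F) (E x) :=
    (hF.fderiv_right (m := 1) (by norm_num)).differentiableAt one_ne_zero
  have hFn : ∀ᶠ y in 𝓝 x, DifferentiableAt ℝ F (E y) :=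
    hE1.continuous.continuousAt.eventually
      ((hF.eventually (by simp)).mono fun y hy => hy.differentiableAt two_ne_zero)
  have heq : fderiv ℝ (F ∘ E) =ᶠ[𝓝 x] fun y => (fderiv ℝ F (E y)).comp (fderiv ℝ E y) :=
    hFn.mono fun y hy => fderiv_comp y hy (hE1 y)
  have hd := (hF2.hasFDerivAt.comp x (hE1 x).hasFDerivAt).clm_comp (hE2 x).hasFDerivAt
  rw [(hd.congr_of_eventuallyEq heq).fderiv]
  refine ContinuousLinearMap.opNorm_le_bound₂ _ (by positivity) fun u w => ?_
  have hu := (fderiv ℝ E x).le_of_opNorm_le hK u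
  have hw := (fderiv ℝ E x).le_of_opNorm_le hK w
  have huw := (fderiv ℝ (fderiv ℝ E) x).le_of_opNorm₂_le_of_le hK' le_rfl le_rfl (x := u) (y := w)
  have b1 := (h2 (fderiv ℝ E x u) (fderiv ℝ E x w)).trans
    (mul_le_mul (mul_le_mul_of_nonneg_left hu hM₂) hw (norm_nonneg _) (by positivity))
  have b2 := (h1 (fderiv ℝ (fderiv ℝ E) x u w)).trans (mul_le_mul_of_nonneg_left huw hM₁)
  have h3 := (norm_add_le _ _).trans (add_le_add b2 b1)
  refine le_trans (le_of_eq ?_) (h3.trans_eq (by ring))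
  simp

/-- Applied to `valueMat`, this identifies `matHess F g X` with the matrix of the functional
`D²F(g)(X, ·)`. -/
theorem fderiv_linearMap_fderiv [FiniteDimensional ℝ V] {F : V → ℝ} {x : V}
    (L : (V →L[ℝ] ℝ) →ₗ[ℝ] W) (hF : DifferentiableAt ℝ (fderiv ℝ F) x) (u : V) :
    fderiv ℝ (fun y => L (fderiv ℝ F y)) x u = L (fderiv ℝ (fderiv ℝ F) x u) := by
  have h := (LinearMap.toContinuousLinearMap L).hasFDerivAt.comp x hF.hasFDerivAt
  exact congrArg (fun φ : V →L[ℝ] W => φ u) h.fderiv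

end ChainRule

/-! ### Gradients and Hessians of functions of a matrix -/

/-- The matrix of values of a linear functional on a doubly indexed family of vectors. -/
def valueMat {V ι : Type*} [NormedAddCommGroup V] [NormedSpace ℝ V] (e : ι → ι → V) :
    (V →L[ℝ] ℝ) →ₗ[ℝ] Matrix ι ι ℝ where
  toFun φ := Matrix.of fun i j => φ (e i j)
  map_add' _ _ := rfl
  map_smul' _ _ := rfl

/-- Cauchy–Schwarz for the Frobenius inner product. -/
theorem norm_apply_le_of_entries (φ : Mat4 →ₗ[ℝ] ℝ) (X : Mat4) :
    ‖φ X‖ ≤ ‖(Matrix.of fun i j => φ (Matrix.single i j 1) : Mat4)‖ * ‖X‖ := by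
  refine le_of_sq_le_sq ?_ (by positivity)
  have hφ : φ X = ∑ i, ∑ j, φ (Matrix.single i j 1) * X i j := by
    conv_lhs => rw [Matrix.matrix_eq_sum_single X]
    simp only [map_sum]
    refine Finset.sum_congr rfl fun i _ => Finset.sum_congr rfl fun j _ => ?_
    have : Matrix.single i j (X i j) = X i j • (Matrix.single i j 1 : Mat4) := by simp
    rw [this, map_smul, smul_eq_mul, mul_comm]
  rw [mul_pow, frobenius_norm_sq, frobenius_norm_sq, Real.norm_eq_abs, sq_abs, hφ]
  simp only [← Fintype.sum_prod_type']
  exact Finset.sum_mul_sq_le_sq_mul_sq _ _ _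

theorem norm_fderiv_apply_le (F : Mat4 → ℝ) (g X : Mat4) :
    ‖fderiv ℝ F g X‖ ≤ ‖matGrad F g‖ * ‖X‖ :=
  norm_apply_le_of_entries (fderiv ℝ F g).toLinearMap X

theorem norm_fderiv_fderiv_apply_le {F : Mat4 → ℝ} {g : Mat4}
    (hF : DifferentiableAt ℝ (fderiv ℝ F) g) (X Y : Mat4) :
    ‖fderiv ℝ (fderiv ℝ F) g X Y‖ ≤ ‖matHess F g X‖ * ‖Y‖ := by
  have h := fderiv_linearMap_fderiv (V := Mat4) (W := Mat4)
    (valueMat fun i j => Matrix.single i j 1) hF X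
  change matHess F g X = _ at h
  rw [h]
  exact norm_apply_le_of_entries (fderiv ℝ (fderiv ℝ F) g X).toLinearMap Y

/-! ### The Lipschitz constant of the gradient -/

theorem DerivBoundsAt.comp_expSE3 {Jt : Mat4 → ℝ} {M₁ M₂ R : ℝ} {θ : LieSE3} (hM₁ : 0 ≤ M₁)
    (hM₂ : 0 ≤ M₂) (h : DerivBoundsAt Jt M₁ M₂ (expSE3 θ)) (hR : 1 ≤ R) (hθ : ‖θ‖ ≤ R) :
    ContDiffAt ℝ 2 (Jt ∘ expSE3) θ ∧
      ‖fderiv ℝ (fderiv ℝ (Jt ∘ expSE3)) θ‖ ≤ 4 * (M₁ + M₂) * R ^ 2 := by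
  obtain ⟨F, hFJ, hF, hF1, hF2⟩ := h
  have htend : Filter.Tendsto expSE3 (𝓝 θ) (𝓝[groupSE3] (expSE3 θ)) :=
    tendsto_nhdsWithin_iff.2 ⟨(contDiff_expSE3 (n := 0)).continuous.continuousAt,
      Filter.Eventually.of_forall expSE3_mem_groupSE3⟩
  have heq : Jt ∘ expSE3 =ᶠ[𝓝 θ] F ∘ expSE3 :=
    (htend.eventually hFJ).mono fun _ hy => hy.symm
  refine ⟨(hF.comp θ contDiff_expSE3.contDiffAt).congr_of_eventuallyEq heq, ?_⟩
  rw [heq.fderiv.fderiv_eq]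
  have hFd : DifferentiableAt ℝ (fderiv ℝ F) (expSE3 θ) :=
    (hF.fderiv_right (m := 1) (by norm_num)).differentiableAt one_ne_zero
  -- Second differences are needed on a full neighbourhood of `θ`, which may lie on the sphere of
  -- radius `R`. Radius `2R` leaves room, and `K' = 4R` still fits the final constant.
  have h2R : ‖θ‖ < 2 * R := by linarith
  refine (norm_fderiv_fderiv_comp_le contDiff_expSE3 hF hM₁ hM₂
    (fun X => (norm_fderiv_apply_le F _ X).trans
      (mul_le_mul_of_nonneg_right hF1 (norm_nonneg X)))
    (fun X Y => (norm_fderiv_fderiv_apply_le hFd X Y).trans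
      (mul_le_mul_of_nonneg_right (hF2 X) (norm_nonneg Y)))
    (K := 2 * R) (K' := 2 * (2 * R)) (by positivity) (by positivity)
    (norm_expSE3_sub_le hR hθ)
    ((continuous_norm.continuousAt.eventually (gt_mem_nhds h2R)).mono fun θ' hθ' k =>
      norm_expSE3_second_difference_le (by linarith) h2R.le hθ'.le k)).trans ?_
  have hRR : M₁ * R ≤ M₁ * R ^ 2 := mul_le_mul_of_nonneg_left (by nlinarith) hM₁
  linarith

theorem proposition3p3 (Jt : Mat4 → ℝ) (J : LieSE3 → ℝ) (hJ : ∀ θ, J θ = Jt (expSE3 θ))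
    (M₁ M₂ : ℝ) (hbound : BoundedClass Jt M₁ M₂) (R : ℝ) (hR : 1 ≤ R) :
    Differentiable ℝ J ∧
    gradLipConst J R ≤ ENNReal.ofReal (5 * (√2 + 1) / 3 * (M₁ + M₂) * R ^ 2) ∧
    |5 * (√2 + 1) / 3 - 4.02| < (0.005 : ℝ) := by
  obtain ⟨hM₁, hM₂, hb⟩ := hbound
  obtain rfl : J = Jt ∘ expSE3 := funext hJ
  have key {r : ℝ} (hr : 1 ≤ r) {θ : LieSE3} (hθ : ‖θ‖ ≤ r) :=
    (hb r (by linarith) (expSE3 θ) ⟨θ, mem_closedBall_zero_iff.2 hθ, rfl⟩).comp_expSE3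
      hM₁ hM₂ hr hθ
  have hs1 : 1.414 < √2 := Real.lt_sqrt_of_sq_lt (by norm_num)
  have hs2 : √2 < 1.4143 := (Real.sqrt_lt' (by norm_num)).2 (by norm_num)
  refine ⟨fun θ => (key (le_max_left 1 ‖θ‖) (le_max_right 1 ‖θ‖)).1.differentiableAt
    two_ne_zero, ?_, ?_⟩
  · refine iSup₂_le fun θ hθ => iSup₂_le fun θ' hθ' => iSup_le fun hne =>
      ENNReal.ofReal_le_ofReal ?_
    rw [div_le_iff₀ (norm_sub_pos_iff.2 hne)]
    have hmvt := (convex_closedBall (0 : LieSE3) R).norm_image_sub_le_of_norm_fderiv_le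
      (f := fderiv ℝ (Jt ∘ expSE3)) (𝕜 := ℝ)
      (fun x hx => ((key hR (mem_closedBall_zero_iff.1 hx)).1.fderiv_right (m := 1)
        (by norm_num)).differentiableAt one_ne_zero)
      (fun x hx => (key hR (mem_closedBall_zero_iff.1 hx)).2) hθ' hθ
    -- The Riesz isometry turns the difference of gradients into that of derivatives.
    rw [gradient, gradient, ← map_sub, LinearIsometryEquiv.norm_map]
    refine hmvt.trans (mul_le_mul_of_nonneg_right ?_ (norm_nonneg _))
    -- What remains is `4 ≤ 5(√2 + 1)/3`, which follows from `√2 > 1.414`.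
    have : 0 ≤ (M₁ + M₂) * R ^ 2 := by positivity
    nlinarith
  · rw [abs_lt]
    constructor <;> norm_num <;> linarith
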